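/- Theorem. Let $d\ge 0$ and $k\ge 0$ be integers. For $f:\mathbb N^d\to\mathbb Q$ and $1\le j\le d$ let $\sigma_j f(n)=f(n+e_j)$ be the $j$-th shift, where $e_j$ is the $j$-th unit vector. A $d$-variate polyrec system in $k$ unknowns consists of polynomials $p_i^{(j)}\in\mathbb Q[x_1,\dots,x_k]$ and rational numbers $c_i$ $(1\le i\le k,\ 1\le j\le d)$; a solution is a tuple $f_1,\dots,f_k:\mathbb N^d\to\mathbb Q$ such that $f_i(0)=c_i$ and $\sigma_j f_i=p_i^{(j)}(f_1,\dots,f_k)$ for all $i,j$, where sums and products of sequences are pointwise. A sequence is polyrec if it is the first component $f_1$ of a solution of some such system with $k\ge 1$. It is decidable whether a polyrec system has a solution: there is a single algorithm which, given $d$, $k$ and the finite data $(p_i^{(j)}),(c_i)$, decides whether the system has a solution. This problem reduces to commutativity of polynomial automata: a polyrec system has a solution if and only if for every $1\le i\le k$ the series recognised by the following polynomial automaton is commutative, i.e. takes the same value on any two words that are permutations of each other. The alphabet is $\{1,\dots,d\}$, the states are the vectors of $\mathbb Q^k$, the initial state is $(c_1,\dots,c_k)$, reading the letter $j$ maps the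 state $q$ to $(p_1^{(j)}(q),\dots,p_k^{(j)}(q))$, and the output at the state $q$ is $q_i$. Hence the syntax of multivariate polyrec sequences is effective: every presentation (with $k\ge 1$) of a solvable system defines exactly one sequence $f_1$, and the sequences $\mathbb N^d\to\mathbb Q$ so defined are exactly the $d$-variate polyrec ones. -/

import Mathlib

/-! ### Systems of polynomial difference equations -/

/-- The `j`-th shift of a `d`-variate sequence:
`(shift j f) (n₁, …, n_j, …, n_d) = f (n₁, …, n_j + 1, …, n_d)`. -/
def shift {d : ℕ} (j : Fin d) (f : (Fin d → ℕ) → ℚ) : (Fin d → ℕ) → ℚ :=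
  fun n => f (n + Pi.single j 1)

/-- A `d`-variate polyrec system in `k` unknown sequences `f₁, …, f_k : ℕ^d → ℚ`: one equation
`shift j f_i = p_i^j (f₁, …, f_k)` for every unknown `i` and every direction `j`, where `p_i^j`
is the polynomial `rhs j i`, together with the initial values `f_i (0, …, 0) = init i`. -/
structure PolyrecSystem (d k : ℕ) where
  rhs : Fin d → Fin k → MvPolynomial (Fin k) ℚ
  init : Fin k → ℚ

namespace PolyrecSystem

/-- The tuple of sequences `f` solves the system. Sums and products of sequences are pointwise. -/
def IsSolution {d k : ℕ} (S : PolyrecSystem d k) (f : Fin k → (Fin d → ℕ) → ℚ) : Prop :=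
  (∀ i, f i 0 = S.init i) ∧
    ∀ (j : Fin d) (i : Fin k) (n : Fin d → ℕ),
      shift j (f i) n = MvPolynomial.eval (fun l => f l n) (S.rhs j i)

/-- The system is consistent: it has a solution. -/
def Solvable {d k : ℕ} (S : PolyrecSystem d k) : Prop :=
  ∃ f : Fin k → (Fin d → ℕ) → ℚ, S.IsSolution f

/-- The system (which has at least one unknown) defines the sequence `f`: it has a solution whose
first component is `f`. -/
def Defines {d k : ℕ} (S : PolyrecSystem d (k + 1)) (f : (Fin d → ℕ) → ℚ) : Prop :=
  ∃ g : Fin (k + 1) → (Fin d → ℕ) → ℚ, S.IsSolution g ∧ g 0 = f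

end PolyrecSystem

/-- Multivariate polynomial recursive sequences. -/
def IsPolyrec {d : ℕ} (f : (Fin d → ℕ) → ℚ) : Prop :=
  ∃ (k : ℕ) (S : PolyrecSystem d (k + 1)), S.Defines f

/-! ### Polynomial automata and commutative series -/

/-- A formal series `A* → ℚ` is commutative if it takes the same value on any two words that are
permutations of each other. -/
def IsCommutativeSeries {A : Type} (s : List A → ℚ) : Prop :=
  ∀ u v : List A, u.Perm v → s u = s v

/-- A polynomial automaton of dimension `k` over the alphabet `A`, with state space `ℚ^k`. -/
structure PolynomialAutomaton (k : ℕ) (A : Type) where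
  start : Fin k → ℚ
  trans : A → Fin k → MvPolynomial (Fin k) ℚ
  out : MvPolynomial (Fin k) ℚ

namespace PolynomialAutomaton

/-- The state reached from `q` after reading one letter. -/
noncomputable def step {k : ℕ} {A : Type} (M : PolynomialAutomaton k A) (q : Fin k → ℚ) (a : A) : Fin k → ℚ :=
  fun i => MvPolynomial.eval q (M.trans a i)

/-- The series recognised by the automaton: read the word from left to right, starting in the
initial state, and apply the output polynomial to the state reached. -/
noncomputable def semantics {k : ℕ} {A : Type} (M : PolynomialAutomaton k A) (w : List A) : ℚ :=
  MvPolynomial.eval (w.foldl M.step M.start) M.out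

end PolynomialAutomaton

/-- The polynomial automaton associated with a polyrec system: the letters are the directions
`1, …, d`, the registers are the unknowns, started at the initial values and updated by the right
hand sides; it outputs the register `i`. -/
noncomputable def PolyrecSystem.automaton {d k : ℕ} (S : PolyrecSystem d k) (i : Fin k) :
    PolynomialAutomaton k (Fin d) where
  start := S.init
  trans := S.rhs
  out := MvPolynomial.X i

/-! ### Finite presentations of polyrec systems

Rational numbers are written as fractions, polynomials as lists of monomials, and a system as the
list of its initial values and the table of its right hand sides. Entries that are missing from a
list are read as `0`, superfluous ones are ignored. -/

/-- `(a, b)` stands for the rational number `a / (b + 1)`. -/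
abbrev RatCode : Type := ℤ × ℕ

/-- `(c, [e₁, …, e_k])` stands for `c * x₁ ^ e₁ * ⋯ * x_k ^ e_k`. -/
abbrev MonomialCode : Type := RatCode × List ℕ

/-- A polynomial is given by the list of its monomials. -/
abbrev PolyCode : Type := List MonomialCode

/-- The list of initial values, and for each direction the list of right hand sides. -/
abbrev SystemCode : Type := List RatCode × List (List PolyCode)

def RatCode.decode (q : RatCode) : ℚ := (q.1 : ℚ) / ((q.2 : ℚ) + 1)

noncomputable def MonomialCode.decode (k : ℕ) (m : MonomialCode) : MvPolynomial (Fin k) ℚ :=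
  MvPolynomial.C (RatCode.decode m.1) * ∏ i : Fin k, MvPolynomial.X i ^ (m.2.getD i 0)

noncomputable def PolyCode.decode (k : ℕ) (p : PolyCode) : MvPolynomial (Fin k) ℚ :=
  (p.map (MonomialCode.decode k)).sum

/-- The `d`-variate polyrec system in `k` unknowns presented by a code. -/
noncomputable def SystemCode.decode (d k : ℕ) (c : SystemCode) : PolyrecSystem d k where
  rhs := fun j i => PolyCode.decode k ((c.2.getD j []).getD i [])
  init := fun i => RatCode.decode (c.1.getD i (0, 0))

theorem RatCode.decode_surjective : Function.Surjective RatCode.decode := by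
  intro q
  refine ⟨(q.num, q.den - 1), ?_⟩
  have h : ((q.den - 1 : ℕ) : ℚ) + 1 = q.den := by
    have := q.pos
    exact_mod_cast Nat.sub_add_cancel this
  simp only [RatCode.decode, h]
  exact Rat.num_div_den q

theorem PolyCode.decode_surjective (k : ℕ) : Function.Surjective (PolyCode.decode k) := by
  intro p
  induction p using MvPolynomial.induction_on' with
  | monomial u a =>
    obtain ⟨q, rfl⟩ := RatCode.decode_surjective a
    refine ⟨[(q, List.ofFn fun i => u i)], ?_⟩
    simp [PolyCode.decode, MonomialCode.decode, MvPolynomial.monomial_eq, Finsupp.prod_fintype]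
  | add p q hp hq =>
    obtain ⟨a, rfl⟩ := hp
    obtain ⟨b, rfl⟩ := hq
    exact ⟨a ++ b, by simp [PolyCode.decode]⟩

/-- Every polyrec system has a finite presentation. -/
theorem SystemCode.decode_surjective (d k : ℕ) :
    Function.Surjective (SystemCode.decode d k) := by
  rintro ⟨r, s⟩
  choose f hf using PolyCode.decode_surjective k
  choose g hg using RatCode.decode_surjective
  refine ⟨(List.ofFn fun i => g (s i), List.ofFn fun j => List.ofFn fun i => f (r j i)), ?_⟩
  simp [SystemCode.decode, hf, hg]

/-!
A solution `f` of a polyrec system is determined by the states of its automata: the state reached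
along a word `w` is `f` evaluated at the vector of letter counts of `w`
(`PolyrecSystem.IsSolution.apply_parikh`). Hence solutions are unique, and one exists iff the state
depends only on the letter counts, which is commutativity of the associated series
(`PolyrecSystem.solvable_iff_isCommutativeSeries`). As permutations are generated by adjacent
transpositions, this means that any two directions commute at every reachable state
(`PolyrecSystem.solvable_iff_next_comm`).

Decidability follows from Post's theorem, because both answers have finite, testable witnesses.
An unsolvable system has a word after which two directions do not commute
(`SystemCode.not_solvable_iff_exists_isObstruction`). For a solvable system, the ideal of all
polynomials vanishing on the reachable states is finitely generated by Hilbert's basis theorem. Its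
generators vanish at the initial state, the ideal they span is stable under the substitutions given
by the right hand sides, and it contains all commutators of the right hand sides; conversely, any
finite family with these properties forces the directions to commute at all reachable states
(`PolyrecSystem.solvable_iff_exists_isCommutationInvariant`). The ideal memberships are witnessed by
cofactors, so that only polynomial identities remain to be tested
(`SystemCode.solvable_iff_exists_isCertificate`).

No symbolic arithmetic on polynomials is needed: a polynomial whose degree in each variable is less
than `N` is zero iff it vanishes on the grid `{0, …, N - 1}^k` (`eq_of_forall_gridPoint`), and the
degrees are bounded by the exponents that occur in the certificate. Thus all tests evaluate
presented polynomials at rational points. Rational numbers are represented by triples of natural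
numbers there, so that primitive recursiveness reduces to that of `+`, `*`, `^`, `/`, `%` on `ℕ` and
of folds over lists.
-/

/-! ### Words and reachable states -/

namespace PolyrecSystem

variable {d k : ℕ} (S : PolyrecSystem d k)

/-- The state reached from `q` after applying the right hand sides of direction `j` once. -/
noncomputable def next (q : Fin k → ℚ) (j : Fin d) : Fin k → ℚ :=
  fun i => MvPolynomial.eval q (S.rhs j i)

/-- The state reached from the initial values along the word `w`. -/
noncomputable def state (w : List (Fin d)) : Fin k → ℚ :=
  w.foldl S.next S.init

/-- The number of occurrences of each letter in a word. -/
def parikh (w : List (Fin d)) : Fin d → ℕ := fun j => w.count j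

/-- The family of polynomials `g` is an inductive invariant which forces the directions to
commute: all `g a` vanish at the initial values, the ideal they generate is stable under the
substitutions `rhs j`, and it contains all commutators of the right hand sides. -/
def IsCommutationInvariant {n : ℕ} (g : Fin n → MvPolynomial (Fin k) ℚ) : Prop :=
  (∀ a, MvPolynomial.eval S.init (g a) = 0) ∧
    (∀ j a, MvPolynomial.bind₁ (S.rhs j) (g a) ∈ Ideal.span (Set.range g)) ∧
    ∀ j l i, MvPolynomial.bind₁ (S.rhs j) (S.rhs l i) - MvPolynomial.bind₁ (S.rhs l) (S.rhs j i) ∈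
      Ideal.span (Set.range g)

@[simp]
theorem state_append_singleton (w : List (Fin d)) (j : Fin d) :
    S.state (w ++ [j]) = S.next (S.state w) j := by
  simp [state]

theorem semantics_automaton (i : Fin k) (w : List (Fin d)) :
    (S.automaton i).semantics w = S.state w i := by
  simp only [PolynomialAutomaton.semantics, automaton, MvPolynomial.eval_X]
  rfl

theorem eval_next (q : Fin k → ℚ) (j : Fin d) (P : MvPolynomial (Fin k) ℚ) :
    MvPolynomial.eval (S.next q j) P = MvPolynomial.eval q (MvPolynomial.bind₁ (S.rhs j) P) := by
  rw [← MvPolynomial.coe_aeval_eq_eval, ← MvPolynomial.coe_aeval_eq_eval]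
  simp only [RingHom.coe_coe, MvPolynomial.aeval_bind₁]
  rfl

theorem parikh_append_singleton (w : List (Fin d)) (j : Fin d) :
    parikh (w ++ [j]) = parikh w + Pi.single j 1 := by
  ext l
  by_cases h : l = j
  · subst h; simp [parikh]
  · simp [parikh, h, Ne.symm h]

theorem parikh_eq_iff_perm {u v : List (Fin d)} : parikh u = parikh v ↔ u.Perm v := by
  rw [List.perm_iff_count, funext_iff]; rfl

theorem exists_parikh_eq (n : Fin d → ℕ) : ∃ w, parikh w = n := by
  refine ⟨(∑ j, Multiset.replicate (n j) j).toList, ?_⟩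
  ext l
  rw [parikh, ← Multiset.coe_count, Multiset.coe_toList, Multiset.count_sum']
  simp [Multiset.count_replicate]

variable {S}

/-- The value of a solution at `n` is read off from the state reached along any word with `n j`
letters `j`, because appending a letter amounts to a shift. -/
theorem IsSolution.apply_parikh {f : Fin k → (Fin d → ℕ) → ℚ} (hf : S.IsSolution f)
    (w : List (Fin d)) (i : Fin k) : f i (parikh w) = S.state w i := by
  induction w using List.reverseRecOn generalizing i with
  | nil => exact hf.1 i
  | append_singleton w j ih =>
    rw [parikh_append_singleton, state_append_singleton, next, ← funext ih]
    exact hf.2 j i (parikh w)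

/-- A system has at most one solution, because every point of `ℕ^d` is reached by shifts from
the origin. -/
theorem IsSolution.unique {f g : Fin k → (Fin d → ℕ) → ℚ} (hf : S.IsSolution f)
    (hg : S.IsSolution g) : f = g := by
  ext i n
  obtain ⟨w, rfl⟩ := exists_parikh_eq n
  rw [hf.apply_parikh, hg.apply_parikh]

theorem solvable_iff_state_eq_of_perm :
    S.Solvable ↔ ∀ u v : List (Fin d), u.Perm v → S.state u = S.state v := by
  constructor
  · rintro ⟨f, hf⟩ u v huv
    ext i
    rw [← hf.apply_parikh, ← hf.apply_parikh, parikh_eq_iff_perm.2 huv]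
  · intro h
    choose word hword using exists_parikh_eq (d := d)
    have key : ∀ n w, parikh w = n → S.state (word n) = S.state w := fun n w hw =>
      h _ _ (parikh_eq_iff_perm.1 ((hword n).trans hw.symm))
    refine ⟨fun i n => S.state (word n) i, fun i => congrFun (key 0 [] rfl) i, fun j i n => ?_⟩
    have := key (n + Pi.single j 1) (word n ++ [j]) (by rw [parikh_append_singleton, hword])
    simp only [shift, this, state_append_singleton, next]

theorem solvable_iff_isCommutativeSeries :
    S.Solvable ↔ ∀ i : Fin k, IsCommutativeSeries (S.automaton i).semantics := by
  simp only [solvable_iff_state_eq_of_perm, IsCommutativeSeries, semantics_automaton, funext_iff]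
  exact ⟨fun h i u v huv => h u v huv i, fun h u v huv i => h i u v huv⟩

/-- Permutations are generated by transpositions of adjacent letters, so it is enough that any two
directions commute at every reachable state. -/
theorem solvable_iff_next_comm :
    S.Solvable ↔ ∀ (w : List (Fin d)) (j l : Fin d),
      S.next (S.next (S.state w) j) l = S.next (S.next (S.state w) l) j := by
  rw [solvable_iff_state_eq_of_perm]
  constructor
  · intro h w j l
    have := h (w ++ [j] ++ [l]) (w ++ [l] ++ [j])
      (by simpa using List.Perm.append_left w (List.Perm.swap l j []))
    simpa only [state_append_singleton] using this
  · intro h u v huv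
    -- An arbitrary common prefix `w` lets the induction pass under a shared first letter.
    have key : ∀ w, S.state (w ++ u) = S.state (w ++ v) := by
      induction huv with
      | nil => simp
      | cons a _ ih => intro w; simpa using ih (w ++ [a])
      | swap a b l =>
        intro w
        have := h w b a
        simp only [state] at this
        simp [state, this]
      | trans _ _ ih₁ ih₂ => intro w; rw [ih₁, ih₂]
    simpa using key []

/-! ### Polynomial invariants of the reachable states -/

variable (S) in
/-- The ideal of all polynomial relations that hold at every reachable state. -/
noncomputable def reachableIdeal : Ideal (MvPolynomial (Fin k) ℚ) :=
  ⨅ w : List (Fin d), RingHom.ker (MvPolynomial.eval (S.state w))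

theorem mem_reachableIdeal {P : MvPolynomial (Fin k) ℚ} :
    P ∈ S.reachableIdeal ↔ ∀ w, MvPolynomial.eval (S.state w) P = 0 := by
  simp [reachableIdeal, RingHom.mem_ker]

/-- Solvability has a finite witness: by Hilbert's basis theorem, finitely many relations generate
the ideal of all relations between the reachable states. -/
theorem solvable_iff_exists_isCommutationInvariant :
    S.Solvable ↔ ∃ (n : ℕ) (g : Fin n → MvPolynomial (Fin k) ℚ), S.IsCommutationInvariant g := by
  rw [solvable_iff_next_comm]
  constructor
  · intro h
    obtain ⟨n, g, hg⟩ := Submodule.fg_iff_exists_fin_generating_family.1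
      (IsNoetherian.noetherian S.reachableIdeal)
    have hmem : ∀ a, g a ∈ S.reachableIdeal := fun a => hg ▸ Submodule.subset_span ⟨a, rfl⟩
    refine ⟨n, g, fun a => mem_reachableIdeal.1 (hmem a) [], fun j a => ?_, fun j l i => ?_⟩
    · rw [Ideal.span, hg, mem_reachableIdeal]
      intro w
      rw [← eval_next, ← state_append_singleton]
      exact mem_reachableIdeal.1 (hmem a) _
    · rw [Ideal.span, hg, mem_reachableIdeal]
      intro w
      rw [map_sub, ← eval_next, ← eval_next, sub_eq_zero]
      exact congrFun (h w j l) i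
  · rintro ⟨n, g, hinit, hstep, hcomm⟩
    have hle : Ideal.span (Set.range g) ≤ S.reachableIdeal := by
      suffices ∀ w, ∀ a, MvPolynomial.eval (S.state w) (g a) = 0 by
        rw [Ideal.span_le]
        rintro _ ⟨a, rfl⟩
        exact mem_reachableIdeal.2 fun w => this w a
      intro w
      induction w using List.reverseRecOn with
      | nil => exact hinit
      | append_singleton w j ih =>
        intro a
        rw [state_append_singleton, eval_next]
        have : Ideal.span (Set.range g) ≤ RingHom.ker (MvPolynomial.eval (S.state w)) := by
          rw [Ideal.span_le]
          rintro _ ⟨a, rfl⟩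
          exact ih a
        exact this (hstep j a)
    intro w j l
    ext i
    have := mem_reachableIdeal.1 (hle (hcomm j l i)) w
    rwa [map_sub, ← eval_next, ← eval_next, sub_eq_zero] at this

end PolyrecSystem

/-! ### Evaluation of presentations -/

/-- `(a, b, c)` stands for the rational number `(a - b) / (c + 1)`. Writing the numerator as a
difference keeps all arithmetic inside `ℕ`. -/
abbrev NatFrac : Type := ℕ × ℕ × ℕ

namespace NatFrac

/-- The rational number represented by a fraction. -/
def val (x : NatFrac) : ℚ := ((x.1 : ℚ) - x.2.1) / (x.2.2 + 1)

/-- The sum of two fractions; the last entry is `(c + 1) * (c' + 1) - 1`, since denominators are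
stored minus one. -/
def add (x y : NatFrac) : NatFrac :=
  (x.1 * (y.2.2 + 1) + y.1 * (x.2.2 + 1), x.2.1 * (y.2.2 + 1) + y.2.1 * (x.2.2 + 1),
    x.2.2 * y.2.2 + x.2.2 + y.2.2)

/-- The product of two fractions. -/
def mul (x y : NatFrac) : NatFrac :=
  (x.1 * y.1 + x.2.1 * y.2.1, x.1 * y.2.1 + x.2.1 * y.1, x.2.2 * y.2.2 + x.2.2 + y.2.2)

/-- Two fractions represent the same rational number (by cross multiplication). -/
def Equiv (x y : NatFrac) : Prop :=
  x.1 * (y.2.2 + 1) + y.2.1 * (x.2.2 + 1) = y.1 * (x.2.2 + 1) + x.2.1 * (y.2.2 + 1)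

/-- A coded rational as a fraction: the integer numerator is split into its positive and
negative parts. -/
def ofRatCode (q : RatCode) : NatFrac := (q.1.toNat, (-q.1).toNat, q.2)

theorem val_zero : val (0, 0, 0) = 0 := by simp [val]

theorem val_one : val (1, 0, 0) = 1 := by simp [val]

theorem val_natCast (n : ℕ) : val (n, 0, 0) = n := by simp [val]

theorem val_add (x y : NatFrac) : (x.add y).val = x.val + y.val := by
  have h1 : (x.2.2 : ℚ) + 1 ≠ 0 := by positivity
  have h2 : (y.2.2 : ℚ) + 1 ≠ 0 := by positivity
  have h3 : ((x.2.2 : ℚ) * y.2.2 + x.2.2 + y.2.2) + 1 = (x.2.2 + 1) * (y.2.2 + 1) := by ring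
  simp only [val, add]
  push_cast
  rw [h3]
  field_simp
  ring

theorem val_mul (x y : NatFrac) : (x.mul y).val = x.val * y.val := by
  have h1 : (x.2.2 : ℚ) + 1 ≠ 0 := by positivity
  have h2 : (y.2.2 : ℚ) + 1 ≠ 0 := by positivity
  have h3 : ((x.2.2 : ℚ) * y.2.2 + x.2.2 + y.2.2) + 1 = (x.2.2 + 1) * (y.2.2 + 1) := by ring
  simp only [val, mul]
  push_cast
  rw [h3]
  field_simp
  ring

theorem equiv_iff {x y : NatFrac} : x.Equiv y ↔ x.val = y.val := by
  have h1 : (x.2.2 : ℚ) + 1 ≠ 0 := by positivity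
  have h2 : (y.2.2 : ℚ) + 1 ≠ 0 := by positivity
  rw [Equiv, val, val, div_eq_div_iff h1 h2, ← @Nat.cast_inj ℚ]
  push_cast
  constructor <;> intro h <;> linarith

theorem val_ofRatCode (q : RatCode) : (ofRatCode q).val = RatCode.decode q := by
  have : ((q.1.toNat : ℤ) - ((-q.1).toNat : ℤ) : ℤ) = q.1 := Int.toNat_sub_toNat_neg q.1
  have h : ((q.1.toNat : ℚ) - ((-q.1).toNat : ℚ)) = q.1 := by
    exact_mod_cast congrArg (Int.cast : ℤ → ℚ) this
  simp only [val, ofRatCode, RatCode.decode, h]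

theorem val_iterate_mul (x y : NatFrac) (n : ℕ) : ((mul x)^[n] y).val = x.val ^ n * y.val := by
  induction n with
  | zero => simp
  | succ n ih => rw [Function.iterate_succ_apply', val_mul, ih, pow_succ']; ring

theorem val_foldl_add {β : Type*} (f : β → NatFrac) (l : List β) (z : NatFrac) :
    (l.foldl (fun acc b => acc.add (f b)) z).val = z.val + (l.map fun b => (f b).val).sum := by
  induction l generalizing z with
  | nil => simp
  | cons b l ih => simp [ih, val_add, add_assoc]

theorem val_foldl_mul {β : Type*} (f : β → NatFrac) (l : List β) (z : NatFrac) :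
    (l.foldl (fun acc b => acc.mul (f b)) z).val = z.val * (l.map fun b => (f b).val).prod := by
  induction l generalizing z with
  | nil => simp
  | cons b l ih => simp [ih, val_mul, mul_assoc]

/-- The point of `ℚ^k` represented by a list of fractions; missing entries are read as `0`. -/
def vec (k : ℕ) (v : List NatFrac) : Fin k → ℚ := fun i => (v.getD i (0, 0, 0)).val

theorem vec_map_range (k : ℕ) (f : ℕ → NatFrac) :
    vec k ((List.range k).map f) = fun i : Fin k => (f i).val := by
  ext i
  simp [vec]

end NatFrac

/-- The value of a monomial at a point. -/
def MonomialCode.eval (k : ℕ) (m : MonomialCode) (v : List NatFrac) : NatFrac :=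
  (List.range k).foldl
    (fun acc i => acc.mul ((NatFrac.mul (v.getD i (0, 0, 0)))^[m.2.getD i 0] (1, 0, 0)))
    (NatFrac.ofRatCode m.1)

/-- The value of a polynomial at a point. -/
def PolyCode.eval (k : ℕ) (p : PolyCode) (v : List NatFrac) : NatFrac :=
  p.foldl (fun acc m => acc.add (MonomialCode.eval k m v)) (0, 0, 0)

theorem MonomialCode.val_eval (k : ℕ) (m : MonomialCode) (v : List NatFrac) :
    (MonomialCode.eval k m v).val =
      MvPolynomial.eval (NatFrac.vec k v) (MonomialCode.decode k m) := by
  rw [MonomialCode.eval, NatFrac.val_foldl_mul]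
  simp only [NatFrac.val_iterate_mul, NatFrac.val_one, mul_one, NatFrac.val_ofRatCode,
    MonomialCode.decode, map_mul, MvPolynomial.eval_C, map_prod, map_pow, MvPolynomial.eval_X]
  congr 1
  exact Finset.prod_range fun i => (v.getD i (0, 0, 0)).val ^ m.2.getD i 0

theorem PolyCode.val_eval (k : ℕ) (p : PolyCode) (v : List NatFrac) :
    (PolyCode.eval k p v).val = MvPolynomial.eval (NatFrac.vec k v) (PolyCode.decode k p) := by
  rw [PolyCode.eval, NatFrac.val_foldl_add, NatFrac.val_zero, zero_add, PolyCode.decode,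
    map_list_sum, List.map_map]
  simp only [MonomialCode.val_eval, Function.comp_def]

/-- The value of `∑ h_a * G_a` at a point. -/
def PolyCode.evalCombination (k : ℕ) (h G : List PolyCode) (v : List NatFrac) : NatFrac :=
  (List.range G.length).foldl
    (fun acc a =>
      acc.add ((PolyCode.eval k (h.getD a []) v).mul (PolyCode.eval k (G.getD a []) v)))
    (0, 0, 0)

/-- The family of polynomials presented by a list. -/
noncomputable def PolyCode.family (k : ℕ) (G : List PolyCode) (a : Fin G.length) :
    MvPolynomial (Fin k) ℚ :=
  PolyCode.decode k (G.getD a [])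

theorem PolyCode.val_evalCombination (k : ℕ) (h G : List PolyCode) (v : List NatFrac) :
    (PolyCode.evalCombination k h G v).val =
      MvPolynomial.eval (NatFrac.vec k v)
        (∑ a : Fin G.length, PolyCode.decode k (h.getD a []) * PolyCode.family k G a) := by
  rw [PolyCode.evalCombination, NatFrac.val_foldl_add, NatFrac.val_zero, zero_add]
  simp only [NatFrac.val_mul, PolyCode.val_eval, map_sum, map_mul, PolyCode.family]
  exact Finset.sum_range fun a => MvPolynomial.eval (NatFrac.vec k v) (decode k (h.getD a [])) *
    MvPolynomial.eval (NatFrac.vec k v) (decode k (G.getD a []))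

namespace SystemCode

/-- The right hand side of a presented system for the direction `j` and the unknown `i`. -/
def rhsCode (c : SystemCode) (j i : ℕ) : PolyCode := (c.2.getD j []).getD i []

/-- The initial state of a presented system. -/
def evalInit (k : ℕ) (c : SystemCode) : List NatFrac :=
  (List.range k).map fun i => NatFrac.ofRatCode (c.1.getD i (0, 0))

/-- The state reached from `v` by one step in direction `j`. -/
def evalNext (k : ℕ) (c : SystemCode) (v : List NatFrac) (j : ℕ) : List NatFrac :=
  (List.range k).map fun i => PolyCode.eval k (c.rhsCode j i) v

/-- The state reached from the initial state along a word. -/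
def evalState (k : ℕ) (c : SystemCode) (w : List ℕ) : List NatFrac :=
  w.foldl (evalNext k c) (evalInit k c)

variable {d k : ℕ} {c : SystemCode}

theorem vec_evalInit : NatFrac.vec k (evalInit k c) = (decode d k c).init := by
  rw [evalInit, NatFrac.vec_map_range]
  ext i
  exact NatFrac.val_ofRatCode _

theorem vec_evalNext (v : List NatFrac) (j : Fin d) :
    NatFrac.vec k (evalNext k c v j) = (decode d k c).next (NatFrac.vec k v) j := by
  rw [evalNext, NatFrac.vec_map_range]
  ext i
  exact PolyCode.val_eval _ _ _

theorem vec_evalState (w : List (Fin d)) :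
    NatFrac.vec k (evalState k c (w.map Fin.val)) = (decode d k c).state w := by
  induction w using List.reverseRecOn with
  | nil => exact vec_evalInit
  | append_singleton w j ih =>
    rw [PolyrecSystem.state_append_singleton, ← ih, ← vec_evalNext]
    simp [evalState]

/-- A witness of unsolvability: two directions `j`, `l` fail to commute in the unknown `i` after
the word `w`. -/
def IsObstruction (d k : ℕ) (c : SystemCode) (w : List ℕ) (j l i : ℕ) : Prop :=
  (∀ a ∈ w, a < d) ∧ j < d ∧ l < d ∧ i < k ∧
    ¬ NatFrac.Equiv
      ((evalNext k c (evalNext k c (evalState k c w) j) l).getD i (0, 0, 0))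
      ((evalNext k c (evalNext k c (evalState k c w) l) j).getD i (0, 0, 0))

theorem not_solvable_iff_exists_isObstruction :
    ¬ (decode d k c).Solvable ↔ ∃ w j l i, IsObstruction d k c w j l i := by
  have key : ∀ (w : List (Fin d)) (j l : Fin d) (i : Fin k),
      NatFrac.Equiv
        ((evalNext k c (evalNext k c (evalState k c (w.map Fin.val)) j) l).getD i (0, 0, 0))
        ((evalNext k c (evalNext k c (evalState k c (w.map Fin.val)) l) j).getD i (0, 0, 0)) ↔
      (decode d k c).next ((decode d k c).next ((decode d k c).state w) j) l i =
        (decode d k c).next ((decode d k c).next ((decode d k c).state w) l) j i := by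
    intro w j l i
    rw [NatFrac.equiv_iff, ← vec_evalState, ← vec_evalNext, ← vec_evalNext, ← vec_evalNext,
      ← vec_evalNext]
    rfl
  rw [PolyrecSystem.solvable_iff_next_comm]
  constructor
  · intro h
    push Not at h
    obtain ⟨w, j, l, h⟩ := h
    obtain ⟨i, hi⟩ := Function.ne_iff.1 h
    exact ⟨w.map Fin.val, j, l, i, by simp, j.2, l.2, i.2, fun he => hi ((key w j l i).1 he)⟩
  · rintro ⟨w, j, l, i, hw, hj, hl, hi, h⟩ hcomm
    lift w to List (Fin d) using hw
    exact h ((key w ⟨j, hj⟩ ⟨l, hl⟩ ⟨i, hi⟩).2 (congrFun (hcomm _ _ _) _))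

end SystemCode

/-! ### Testing polynomial identities on a grid -/

/-- All exponents of the presented polynomial are at most `D`. -/
def PolyCode.ExponentsLE (k D : ℕ) (p : PolyCode) : Prop :=
  ∀ m ∈ p, ∀ i < k, m.2.getD i 0 ≤ D

theorem PolyCode.degreeOf_decode_le {k D : ℕ} {p : PolyCode} (hp : PolyCode.ExponentsLE k D p)
    (i : Fin k) : (PolyCode.decode k p).degreeOf i ≤ D := by
  induction p with
  | nil => simp [PolyCode.decode]
  | cons m p ih =>
    rw [PolyCode.decode, List.map_cons, List.sum_cons]
    refine (MvPolynomial.degreeOf_add_le _ _ _).trans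
      (max_le ?_ (ih fun m' hm' => hp m' (List.mem_cons_of_mem _ hm')))
    refine (MvPolynomial.degreeOf_C_mul_le _ _ _).trans ?_
    refine (MvPolynomial.degreeOf_prod_le _ _ _).trans ?_
    rw [Finset.sum_eq_single_of_mem i (Finset.mem_univ i)]
    · simpa using hp m List.mem_cons_self i i.2
    · intro l _ hl
      exact MvPolynomial.degreeOf_X_pow_of_ne _ hl.symm

theorem MvPolynomial.degreeOf_bind₁_le {R σ τ : Type*} [CommSemiring R] [Fintype σ] {D E : ℕ}
    {f : σ → MvPolynomial τ R} {P : MvPolynomial σ R} (i : τ) (hf : ∀ l, (f l).degreeOf i ≤ D)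
    (hP : ∀ l, P.degreeOf l ≤ E) :
    (MvPolynomial.bind₁ f P).degreeOf i ≤ Fintype.card σ * (E * D) := by
  rw [MvPolynomial.bind₁, MvPolynomial.aeval_def, MvPolynomial.eval₂_eq']
  refine (MvPolynomial.degreeOf_sum_le _ _ _).trans (Finset.sup_le fun m hm => ?_)
  refine (MvPolynomial.degreeOf_C_mul_le _ _ _).trans ?_
  refine (MvPolynomial.degreeOf_prod_le _ _ _).trans ?_
  refine (Finset.sum_le_card_nsmul _ _ (E * D) fun l _ => ?_).trans (by simp)
  exact (MvPolynomial.degreeOf_pow_le _ _ _).trans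
    (Nat.mul_le_mul ((MvPolynomial.degreeOf_le_iff.1 (hP l)) m hm) (hf l))

/-- The point of the grid `{0, …, N - 1}^k` whose coordinates are the base `N` digits of `t`. -/
def gridPoint (k N t : ℕ) : List NatFrac :=
  (List.range k).map fun i => (t / N ^ i % N, 0, 0)

/-- Polynomials of degree less than `N` in each variable are determined by their values on the
grid `{0, …, N - 1}^k`. -/
theorem eq_of_forall_gridPoint {k N : ℕ} {P Q : MvPolynomial (Fin k) ℚ}
    (hP : ∀ i, P.degreeOf i < N) (hQ : ∀ i, Q.degreeOf i < N)
    (h : ∀ t < N ^ k, MvPolynomial.eval (NatFrac.vec k (gridPoint k N t)) P =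
      MvPolynomial.eval (NatFrac.vec k (gridPoint k N t)) Q) : P = Q := by
  rw [← sub_eq_zero]
  refine MvPolynomial.eq_zero_of_eval_zero_at_prod_finset _
    (fun _ => (Finset.range N).map Nat.castEmbedding) (fun i => ?_) fun x hx => ?_
  · rw [Finset.card_map, Finset.card_range]
    exact (MvPolynomial.degreeOf_sub_le _ _ _).trans_lt (max_lt (hP i) (hQ i))
  · have hx' : ∀ i, ∃ y : Fin N, (y : ℚ) = x i := fun i => by
      obtain ⟨y, hy, he⟩ := Finset.mem_map.1 (hx i)
      exact ⟨⟨y, Finset.mem_range.1 hy⟩, he⟩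
    choose y hy using hx'
    -- `finFunctionFinEquiv y` is the number whose base `N` digits are the coordinates `y`.
    have hvec : NatFrac.vec k (gridPoint k N (finFunctionFinEquiv y)) = x := by
      rw [gridPoint, NatFrac.vec_map_range]
      ext i
      rw [NatFrac.val_natCast, ← hy i, ← finFunctionFinEquiv_symm_apply_val, Equiv.symm_apply_apply]
    rw [← hvec, map_sub, sub_eq_zero]
    exact h _ (finFunctionFinEquiv y).2

theorem PolyCode.exponentsLE_getD {k D : ℕ} {h : List PolyCode}
    (hh : ∀ p ∈ h, PolyCode.ExponentsLE k D p) (a : ℕ) :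
    PolyCode.ExponentsLE k D (h.getD a []) := by
  rw [List.getD_eq_getElem?_getD]
  rcases lt_or_ge a h.length with ha | ha
  · simpa [ha] using hh _ (List.getElem_mem ha)
  · simp [ha, PolyCode.ExponentsLE]

theorem PolyCode.degreeOf_combination_le {k D : ℕ} {h G : List PolyCode}
    (hh : ∀ p ∈ h, PolyCode.ExponentsLE k D p) (hG : ∀ p ∈ G, PolyCode.ExponentsLE k D p)
    (i : Fin k) :
    (∑ a : Fin G.length, PolyCode.decode k (h.getD a []) * PolyCode.family k G a).degreeOf i ≤
      2 * D := by
  refine (MvPolynomial.degreeOf_sum_le _ _ _).trans (Finset.sup_le fun a _ => ?_)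
  refine (MvPolynomial.degreeOf_mul_le _ _ _).trans ?_
  rw [two_mul]
  exact add_le_add (PolyCode.degreeOf_decode_le (PolyCode.exponentsLE_getD hh a) i)
    (PolyCode.degreeOf_decode_le (PolyCode.exponentsLE_getD hG a) i)

/-- Any finite list of presentations has a common bound on its exponents. -/
theorem PolyCode.eventually_exponentsLE (k : ℕ) (L : List PolyCode) :
    ∀ᶠ D in Filter.atTop, ∀ p ∈ L, PolyCode.ExponentsLE k D p := by
  refine (Filter.eventually_all_finite L.finite_toSet).2 fun p _ => ?_
  refine (Filter.eventually_all_finite p.finite_toSet).2 fun m _ => ?_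
  exact (Filter.eventually_all_finite (Set.finite_lt_nat k)).2 fun i _ =>
    Filter.eventually_ge_atTop _

/-- Every element of the ideal generated by a presented family is a combination with presented
cofactors. -/
theorem PolyCode.exists_combination_eq {k : ℕ} {G : List PolyCode} {P : MvPolynomial (Fin k) ℚ}
    (hP : P ∈ Ideal.span (Set.range (PolyCode.family k G))) :
    ∃ h : List PolyCode,
      ∑ a : Fin G.length, PolyCode.decode k (h.getD a []) * PolyCode.family k G a = P := by
  obtain ⟨q, rfl⟩ := Ideal.mem_span_range_iff_exists_fun.1 hP
  choose f hf using PolyCode.decode_surjective k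
  exact ⟨List.ofFn fun a => f (q a), by simp [hf]⟩

theorem PolyCode.combination_mem_span (k : ℕ) (h G : List PolyCode) :
    ∑ a : Fin G.length, PolyCode.decode k (h.getD a []) * PolyCode.family k G a ∈
      Ideal.span (Set.range (PolyCode.family k G)) :=
  Ideal.mem_span_range_iff_exists_fun.2 ⟨_, rfl⟩

/-! ### Certificates of solvability -/

namespace SystemCode

/-- A grid with this side length separates the polynomials that occur in a certificate whose
exponents are at most `D`: `k * (D * D)` bounds the degrees of composites, and `2 * D` those of
the combinations. -/
def gridSize (k D : ℕ) : ℕ := k * (D * D) + 2 * D + 1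

/-- The identity `g ∘ rhs j = ∑ h_a * G_a`, tested on the grid. -/
def StepIdentity (k : ℕ) (c : SystemCode) (N : ℕ) (G : List PolyCode) (j : ℕ) (g : PolyCode)
    (h : List PolyCode) : Prop :=
  ∀ t < N ^ k, NatFrac.Equiv (PolyCode.eval k g (evalNext k c (gridPoint k N t) j))
    (PolyCode.evalCombination k h G (gridPoint k N t))

/-- The identity `rhs l i ∘ rhs j = rhs j i ∘ rhs l + ∑ h_a * G_a`, tested on the grid. -/
def CommIdentity (k : ℕ) (c : SystemCode) (N : ℕ) (G : List PolyCode) (j l i : ℕ)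
    (h : List PolyCode) : Prop :=
  ∀ t < N ^ k, NatFrac.Equiv
    (PolyCode.eval k (c.rhsCode l i) (evalNext k c (gridPoint k N t) j))
    (NatFrac.add (PolyCode.eval k (c.rhsCode j i) (evalNext k c (gridPoint k N t) l))
      (PolyCode.evalCombination k h G (gridPoint k N t)))

/-- A certificate of solvability: a list `G` presenting a commutation invariant, a list `H` of
cofactor vectors which express the membership conditions as polynomial identities, and a bound `D`
for all exponents, which makes these identities testable on a finite grid. -/
def IsCertificate (d k : ℕ) (c : SystemCode) (D : ℕ) (G : List PolyCode)
    (H : List (List PolyCode)) : Prop :=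
  (∀ j < d, ∀ i < k, PolyCode.ExponentsLE k D (c.rhsCode j i)) ∧
  (∀ g ∈ G, PolyCode.ExponentsLE k D g) ∧
  (∀ h ∈ H, ∀ p ∈ h, PolyCode.ExponentsLE k D p) ∧
  (∀ g ∈ G, NatFrac.Equiv (PolyCode.eval k g (evalInit k c)) (0, 0, 0)) ∧
  (∀ j < d, ∀ g ∈ G, ∃ h ∈ H, StepIdentity k c (gridSize k D) G j g h) ∧
  ∀ j < d, ∀ l < d, ∀ i < k, ∃ h ∈ H, CommIdentity k c (gridSize k D) G j l i h

variable {d k : ℕ} {c : SystemCode}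

theorem stepIdentity_iff {N : ℕ} {G h : List PolyCode} {j : Fin d} {g : PolyCode} :
    StepIdentity k c N G j g h ↔ ∀ t < N ^ k,
      MvPolynomial.eval (NatFrac.vec k (gridPoint k N t))
        (MvPolynomial.bind₁ ((decode d k c).rhs j) (PolyCode.decode k g)) =
      MvPolynomial.eval (NatFrac.vec k (gridPoint k N t))
        (∑ a : Fin G.length, PolyCode.decode k (h.getD a []) * PolyCode.family k G a) := by
  simp only [StepIdentity, NatFrac.equiv_iff, PolyCode.val_eval, PolyCode.val_evalCombination,
    vec_evalNext, PolyrecSystem.eval_next]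

theorem commIdentity_iff {N : ℕ} {G h : List PolyCode} {j l : Fin d} {i : Fin k} :
    CommIdentity k c N G j l i h ↔ ∀ t < N ^ k,
      MvPolynomial.eval (NatFrac.vec k (gridPoint k N t))
        (MvPolynomial.bind₁ ((decode d k c).rhs j) ((decode d k c).rhs l i) -
          MvPolynomial.bind₁ ((decode d k c).rhs l) ((decode d k c).rhs j i)) =
      MvPolynomial.eval (NatFrac.vec k (gridPoint k N t))
        (∑ a : Fin G.length, PolyCode.decode k (h.getD a []) * PolyCode.family k G a) := by
  simp only [CommIdentity, NatFrac.equiv_iff, NatFrac.val_add, PolyCode.val_eval,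
    PolyCode.val_evalCombination, vec_evalNext, PolyrecSystem.eval_next]
  simp only [map_sub, sub_eq_iff_eq_add']
  rfl

/-- Certificates are sound: by the degree bounds, an identity that holds on the grid holds between
polynomials. -/
theorem isCommutationInvariant_of_isCertificate {D : ℕ} {G : List PolyCode}
    {H : List (List PolyCode)} (hc : IsCertificate d k c D G H) :
    (decode d k c).IsCommutationInvariant (PolyCode.family k G) := by
  obtain ⟨hR, hG, hH, hinit, hstep, hcomm⟩ := hc
  have hRdeg : ∀ (j : Fin d) (i l : Fin k), ((decode d k c).rhs j i).degreeOf l ≤ D :=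
    fun j i l => PolyCode.degreeOf_decode_le (hR j j.2 i i.2) l
  have hmem : ∀ a : Fin G.length, G.getD a [] ∈ G := fun a => by simp
  have hcombi : ∀ h ∈ H, ∀ i : Fin k,
      (∑ a : Fin G.length, PolyCode.decode k (h.getD a []) * PolyCode.family k G a).degreeOf i <
        gridSize k D := fun h hh i =>
    (PolyCode.degreeOf_combination_le (hH h hh) hG i).trans_lt (by unfold gridSize; lia)
  refine ⟨fun a => ?_, fun j a => ?_, fun j l i => ?_⟩
  · have := hinit _ (hmem a)
    rwa [NatFrac.equiv_iff, PolyCode.val_eval, NatFrac.val_zero, vec_evalInit (d := d)] at this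
  · obtain ⟨h, hh, hid⟩ := hstep j j.2 _ (hmem a)
    rw [PolyCode.family,
      eq_of_forall_gridPoint (fun i => ?_) (hcombi h hh) (stepIdentity_iff.1 hid)]
    · exact PolyCode.combination_mem_span _ _ _
    · refine (MvPolynomial.degreeOf_bind₁_le i (fun l => hRdeg j l i)
        (PolyCode.degreeOf_decode_le (hG _ (hmem a)))).trans_lt ?_
      simp only [gridSize, Fintype.card_fin]; lia
  · obtain ⟨h, hh, hid⟩ := hcomm j j.2 l l.2 i i.2
    rw [eq_of_forall_gridPoint (fun i' => ?_) (hcombi h hh) (commIdentity_iff.1 hid)]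
    · exact PolyCode.combination_mem_span _ _ _
    · refine (MvPolynomial.degreeOf_sub_le _ _ _).trans_lt
        ((max_le (MvPolynomial.degreeOf_bind₁_le i' (fun i => hRdeg j i i') (hRdeg l i))
          (MvPolynomial.degreeOf_bind₁_le i' (fun i => hRdeg l i i') (hRdeg j i))).trans_lt ?_)
      simp only [gridSize, Fintype.card_fin]; lia

/-- Conversely, an invariant yields a certificate: present the `g a` and the finitely many cofactors
of the ideal memberships, and take any bound on all the exponents involved. -/
theorem exists_isCertificate {n : ℕ} {g : Fin n → MvPolynomial (Fin k) ℚ}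
    (hg : (decode d k c).IsCommutationInvariant g) : ∃ D G H, IsCertificate d k c D G H := by
  choose f hf using PolyCode.decode_surjective k
  set G : List PolyCode := List.ofFn fun a => f (g a) with hGdef
  have hrange : Set.range (PolyCode.family k G) = Set.range g := by
    have hlen : G.length = n := List.length_ofFn
    have : PolyCode.family k G = g ∘ Fin.cast hlen := by
      ext1 a
      have ha : (a : ℕ) < n := hlen ▸ a.2
      simp [PolyCode.family, hGdef, ha, hf, Fin.cast]
    rw [this]
    exact (finCongr hlen).surjective.range_comp g
  obtain ⟨hinit, hstep, hcomm⟩ := hg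
  rw [← hrange] at hstep hcomm
  choose h₁ hh₁ using fun j a => PolyCode.exists_combination_eq (hstep j a)
  choose h₂ hh₂ using fun j l i => PolyCode.exists_combination_eq (hcomm j l i)
  let H : List (List PolyCode) :=
    ((Finset.univ.image fun x : Fin d × Fin n => h₁ x.1 x.2) ∪
      Finset.univ.image fun x : Fin d × Fin d × Fin k => h₂ x.1 x.2.1 x.2.2).toList
  have hH₁ : ∀ j a, h₁ j a ∈ H := fun j a => by
    simp only [H, Finset.mem_toList, Finset.mem_union, Finset.mem_image, Finset.mem_univ, true_and]
    exact Or.inl ⟨(j, a), rfl⟩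
  have hH₂ : ∀ j l i, h₂ j l i ∈ H := fun j l i => by
    simp only [H, Finset.mem_toList, Finset.mem_union, Finset.mem_image, Finset.mem_univ, true_and]
    exact Or.inr ⟨(j, l, i), rfl⟩
  let R : List PolyCode :=
    (Finset.univ.image fun x : Fin d × Fin k => c.rhsCode x.1 x.2).toList
  obtain ⟨D, hD⟩ := (PolyCode.eventually_exponentsLE k (R ++ G ++ H.flatten)).exists
  refine ⟨D, G, H, fun j hj i hi => hD _ ?_, fun p hp => hD _ ?_, fun h hh p hp => hD _ ?_, ?_, ?_,
    ?_⟩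
  · simp only [R, List.mem_append, Finset.mem_toList, Finset.mem_image, Finset.mem_univ, true_and]
    exact Or.inl (Or.inl ⟨(⟨j, hj⟩, ⟨i, hi⟩), rfl⟩)
  · simp [hp]
  · exact List.mem_append_right _ (List.mem_flatten.2 ⟨h, hh, hp⟩)
  · intro p hp
    obtain ⟨a, rfl⟩ := (List.mem_ofFn' _ _).1 hp
    rw [NatFrac.equiv_iff, PolyCode.val_eval, NatFrac.val_zero, vec_evalInit (d := d), hf]
    exact hinit a
  · intro j hj p hp
    obtain ⟨a, rfl⟩ := (List.mem_ofFn' _ _).1 hp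
    refine ⟨_, hH₁ ⟨j, hj⟩ a, (stepIdentity_iff (j := ⟨j, hj⟩)).2 fun t _ => ?_⟩
    rw [hh₁, hf]
  · intro j hj l hl i hi
    refine ⟨_, hH₂ ⟨j, hj⟩ ⟨l, hl⟩ ⟨i, hi⟩,
      (commIdentity_iff (j := ⟨j, hj⟩) (l := ⟨l, hl⟩) (i := ⟨i, hi⟩)).2 fun t _ => ?_⟩
    rw [hh₂]

theorem solvable_iff_exists_isCertificate :
    (decode d k c).Solvable ↔ ∃ D G H, IsCertificate d k c D G H := by
  rw [PolyrecSystem.solvable_iff_exists_isCommutationInvariant]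
  exact ⟨fun ⟨_, _, hg⟩ => exists_isCertificate hg,
    fun ⟨_, _, _, hc⟩ => ⟨_, _, isCommutationInvariant_of_isCertificate hc⟩⟩

end SystemCode

/-! ### Primitive recursiveness of the tests -/

section Quantifiers

variable {α β : Type*} [Primcodable α] [Primcodable β]

theorem PrimrecPred.forall_lt_comp {p : α → ℕ → Prop} {f : α → ℕ}
    (hp : PrimrecPred fun x : α × ℕ => p x.1 x.2) (hf : Primrec f) :
    PrimrecPred fun a => ∀ i < f a, p a i :=
  ((hp.primrecRel.comp₂ Primrec₂.right Primrec₂.left).forall_mem_list.comp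
    (Primrec.list_range.comp hf) .id).of_eq fun a => by simp

theorem PrimrecPred.forall_mem_comp {p : α → β → Prop} {f : α → List β}
    (hp : PrimrecPred fun x : α × β => p x.1 x.2) (hf : Primrec f) :
    PrimrecPred fun a => ∀ b ∈ f a, p a b :=
  (hp.primrecRel.comp₂ Primrec₂.right Primrec₂.left).forall_mem_list.comp hf .id

theorem PrimrecPred.exists_mem_comp {p : α → β → Prop} {f : α → List β}
    (hp : PrimrecPred fun x : α × β => p x.1 x.2) (hf : Primrec f) :
    PrimrecPred fun a => ∃ b ∈ f a, p a b :=
  (hp.primrecRel.comp₂ Primrec₂.right Primrec₂.left).exists_mem_list.comp hf .id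

/-- The projection of a primitive recursive relation is recursively enumerable, by unbounded
search. -/
theorem PrimrecRel.rePred_exists {R : α → β → Prop} (hR : PrimrecRel R) :
    REPred fun a => ∃ b, R a b := by
  classical
  have h : Partrec fun a => Nat.rfindOpt fun n =>
      (Encodable.decode (α := β) n).bind fun b => if R a b then some () else none := by
    refine Partrec.rfindOpt (Primrec.to_comp ?_)
    refine Primrec.option_bind (Primrec.decode.comp .snd) ?_
    exact Primrec.ite (hR.comp (Primrec.fst.comp .fst) .snd) (.const _) (.const _)
  refine h.dom_re.of_eq fun a => ?_
  rw [Nat.rfindOpt_dom]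
  constructor
  · rintro ⟨n, u, hu⟩
    obtain ⟨b, -, hb⟩ := Option.bind_eq_some_iff.1 hu
    exact ⟨b, by_contra fun hn => by simp [hn] at hb⟩
  · rintro ⟨b, hb⟩
    exact ⟨Encodable.encode b, (), by simp [hb]⟩

end Quantifiers

section Evaluation

open Primrec

/-- Integers are encoded by `n ↦ 2 * n` and `-(n + 1) ↦ 2 * n + 1`, so the sign is the parity of the
code. -/
theorem Primrec.int_toNat : Primrec Int.toNat := by
  refine (Primrec.cond (nat_bodd.comp .encode) (.const 0) (nat_div2.comp .encode)).of_eq fun z => ?_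
  cases z with
  | ofNat n =>
    rw [show Encodable.encode (Int.ofNat n) = 2 * n from rfl]
    simp [Nat.div2_val]
  | negSucc n =>
    rw [show Encodable.encode (Int.negSucc n) = 2 * n + 1 from rfl]
    simp

theorem Primrec.int_toNat_neg : Primrec fun z : ℤ => (-z).toNat := by
  refine (Primrec.cond (nat_bodd.comp .encode) (Primrec.succ.comp (nat_div2.comp .encode))
    (.const 0)).of_eq fun z => ?_
  cases z with
  | ofNat n =>
    rw [show Encodable.encode (Int.ofNat n) = 2 * n from rfl]
    simp
  | negSucc n =>
    rw [show Encodable.encode (Int.negSucc n) = 2 * n + 1 from rfl]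
    simp [Nat.div2_val, Int.neg_negSucc]

variable {α : Type*} [Primcodable α]

theorem Primrec.nat_pow_comp {f g : α → ℕ} (hf : Primrec f) (hg : Primrec g) :
    Primrec fun a => f a ^ g a :=
  (Primrec₂.unpaired'.1 Nat.Primrec.pow).comp hf hg

namespace NatFrac

theorem primrec_mul_add_mul {f g h k : α → ℕ} (hf : Primrec f) (hg : Primrec g) (hh : Primrec h)
    (hk : Primrec k) : Primrec fun a => f a * g a + h a * k a :=
  nat_add.comp (nat_mul.comp hf hg) (nat_mul.comp hh hk)

theorem primrec_den {f g : α → ℕ} (hf : Primrec f) (hg : Primrec g) :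
    Primrec fun a => f a * g a + f a + g a :=
  nat_add.comp (nat_add.comp (nat_mul.comp hf hg) hf) hg

section

variable {x y : α → NatFrac} (hx : Primrec x) (hy : Primrec y)
include hx hy

theorem primrec_add : Primrec fun a => (x a).add (y a) := by
  have x₁ := fst.comp hx
  have x₂ := fst.comp (snd.comp hx)
  have x₃ := snd.comp (snd.comp hx)
  have y₁ := fst.comp hy
  have y₂ := fst.comp (snd.comp hy)
  have y₃ := snd.comp (snd.comp hy)
  exact (primrec_mul_add_mul x₁ (succ.comp y₃) y₁ (succ.comp x₃)).pair
    ((primrec_mul_add_mul x₂ (succ.comp y₃) y₂ (succ.comp x₃)).pair (primrec_den x₃ y₃))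

theorem primrec_mul : Primrec fun a => (x a).mul (y a) := by
  have x₁ := fst.comp hx
  have x₂ := fst.comp (snd.comp hx)
  have x₃ := snd.comp (snd.comp hx)
  have y₁ := fst.comp hy
  have y₂ := fst.comp (snd.comp hy)
  have y₃ := snd.comp (snd.comp hy)
  exact (primrec_mul_add_mul x₁ y₁ x₂ y₂).pair
    ((primrec_mul_add_mul x₁ y₂ x₂ y₁).pair (primrec_den x₃ y₃))

theorem primrecPred_equiv : PrimrecPred fun a => (x a).Equiv (y a) := by
  have x₁ := fst.comp hx
  have x₂ := fst.comp (snd.comp hx)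
  have x₃ := snd.comp (snd.comp hx)
  have y₁ := fst.comp hy
  have y₂ := fst.comp (snd.comp hy)
  have y₃ := snd.comp (snd.comp hy)
  exact Primrec.eq.comp (primrec_mul_add_mul x₁ (succ.comp y₃) y₂ (succ.comp x₃))
    (primrec_mul_add_mul y₁ (succ.comp x₃) x₂ (succ.comp y₃))

end

theorem primrec_ofRatCode {q : α → RatCode} (hq : Primrec q) :
    Primrec fun a => ofRatCode (q a) :=
  (int_toNat.comp (fst.comp hq)).pair ((int_toNat_neg.comp (fst.comp hq)).pair (snd.comp hq))

end NatFrac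

section

variable {k : α → ℕ} {v : α → List NatFrac} (hk : Primrec k) (hv : Primrec v)
include hk hv

theorem MonomialCode.primrec_eval {m : α → MonomialCode} (hm : Primrec m) :
    Primrec fun a => MonomialCode.eval (k a) (m a) (v a) := by
  refine list_foldl (h := fun a (s : NatFrac × _) => s.1.mul
    ((NatFrac.mul ((v a).getD s.2 (0, 0, 0)))^[(m a).2.getD s.2 0] (1, 0, 0)))
    (list_range.comp hk) (NatFrac.primrec_ofRatCode (fst.comp hm)) ?_
  refine NatFrac.primrec_mul (fst.comp snd) ?_
  have hi : Primrec fun p : α × NatFrac × ℕ => p.2.2 := snd.comp snd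
  refine nat_iterate ((list_getD 0).comp (snd.comp (hm.comp fst)) hi) (.const _) ?_
  exact NatFrac.primrec_mul ((list_getD _).comp (hv.comp (fst.comp fst)) (hi.comp fst)) snd

theorem PolyCode.primrec_eval {p : α → PolyCode} (hp : Primrec p) :
    Primrec fun a => PolyCode.eval (k a) (p a) (v a) := by
  refine list_foldl (h := fun a (s : NatFrac × _) => s.1.add (MonomialCode.eval (k a) s.2 (v a)))
    hp (.const _) ?_
  exact NatFrac.primrec_add (fst.comp snd)
    (MonomialCode.primrec_eval (hk.comp fst) (hv.comp fst) (snd.comp snd))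

theorem PolyCode.primrec_evalCombination {h G : α → List PolyCode} (hh : Primrec h)
    (hG : Primrec G) : Primrec fun a => PolyCode.evalCombination (k a) (h a) (G a) (v a) := by
  refine list_foldl (h := fun a (s : NatFrac × _) => s.1.add
      ((PolyCode.eval (k a) ((h a).getD s.2 []) (v a)).mul
        (PolyCode.eval (k a) ((G a).getD s.2 []) (v a))))
    (list_range.comp (list_length.comp hG)) (.const _) ?_
  have hi : Primrec fun p : α × NatFrac × ℕ => p.2.2 := snd.comp snd
  exact NatFrac.primrec_add (fst.comp snd) (NatFrac.primrec_mul
    (PolyCode.primrec_eval (hk.comp fst) (hv.comp fst) ((list_getD []).comp (hh.comp fst) hi))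
    (PolyCode.primrec_eval (hk.comp fst) (hv.comp fst) ((list_getD []).comp (hG.comp fst) hi)))

end

theorem primrec_gridPoint {k N t : α → ℕ} (hk : Primrec k) (hN : Primrec N) (ht : Primrec t) :
    Primrec fun a => gridPoint (k a) (N a) (t a) := by
  refine list_map (g := fun a i => (t a / N a ^ i % N a, 0, 0)) (list_range.comp hk) ?_
  have hN' : Primrec fun p : α × ℕ => N p.1 := hN.comp fst
  exact (nat_mod.comp (nat_div.comp (ht.comp fst) (nat_pow_comp hN' snd)) hN').pair (.const _)

theorem PolyCode.primrecPred_exponentsLE {k D : α → ℕ} {p : α → PolyCode} (hk : Primrec k)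
    (hD : Primrec D) (hp : Primrec p) :
    PrimrecPred fun a => PolyCode.ExponentsLE (k a) (D a) (p a) := by
  refine PrimrecPred.forall_mem_comp ?_ hp
  refine PrimrecPred.forall_lt_comp ?_ (hk.comp fst)
  exact nat_le.comp ((list_getD 0).comp (snd.comp (snd.comp fst)) snd) (hD.comp (fst.comp fst))

namespace SystemCode

theorem primrec_rhsCode {c : α → SystemCode} {j i : α → ℕ} (hc : Primrec c) (hj : Primrec j)
    (hi : Primrec i) : Primrec fun a => (c a).rhsCode (j a) (i a) :=
  (list_getD []).comp ((list_getD []).comp (snd.comp hc) hj) hi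

theorem primrec_evalInit {k : α → ℕ} {c : α → SystemCode} (hk : Primrec k) (hc : Primrec c) :
    Primrec fun a => evalInit (k a) (c a) := by
  refine list_map (g := fun a i => NatFrac.ofRatCode ((c a).1.getD i (0, 0)))
    (list_range.comp hk) ?_
  exact NatFrac.primrec_ofRatCode ((list_getD _).comp (fst.comp (hc.comp fst)) snd)

theorem primrec_evalNext {k : α → ℕ} {c : α → SystemCode} {v : α → List NatFrac} {j : α → ℕ}
    (hk : Primrec k) (hc : Primrec c) (hv : Primrec v) (hj : Primrec j) :
    Primrec fun a => evalNext (k a) (c a) (v a) (j a) := by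
  refine list_map (g := fun a i => PolyCode.eval (k a) ((c a).rhsCode (j a) i) (v a))
    (list_range.comp hk) ?_
  exact PolyCode.primrec_eval (hk.comp fst) (hv.comp fst)
    (primrec_rhsCode (hc.comp fst) (hj.comp fst) snd)

theorem primrec_evalState {k : α → ℕ} {c : α → SystemCode} {w : α → List ℕ}
    (hk : Primrec k) (hc : Primrec c) (hw : Primrec w) :
    Primrec fun a => evalState (k a) (c a) (w a) := by
  refine list_foldl (h := fun a s => evalNext (k a) (c a) s.1 s.2) hw (primrec_evalInit hk hc) ?_
  exact primrec_evalNext (hk.comp fst) (hc.comp fst) (fst.comp snd) (snd.comp snd)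

theorem primrec_gridSize {k D : α → ℕ} (hk : Primrec k) (hD : Primrec D) :
    Primrec fun a => gridSize (k a) (D a) :=
  succ.comp (nat_add.comp (nat_mul.comp hk (nat_mul.comp hD hD)) (nat_mul.comp (.const 2) hD))

theorem primrecPred_isObstruction {d k j l i : α → ℕ} {c : α → SystemCode} {w : α → List ℕ}
    (hd : Primrec d) (hk : Primrec k) (hc : Primrec c) (hw : Primrec w) (hj : Primrec j)
    (hl : Primrec l) (hi : Primrec i) :
    PrimrecPred fun a => IsObstruction (d a) (k a) (c a) (w a) (j a) (l a) (i a) := by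
  have hs := primrec_evalState hk hc hw
  refine PrimrecPred.and (PrimrecPred.forall_mem_comp ?_ hw) <|
    (nat_lt.comp hj hd).and <| (nat_lt.comp hl hd).and <| (nat_lt.comp hi hk).and <|
    PrimrecPred.not <| NatFrac.primrecPred_equiv ?_ ?_
  · exact nat_lt.comp snd (hd.comp fst)
  · exact (list_getD _).comp (primrec_evalNext hk hc (primrec_evalNext hk hc hs hj) hl) hi
  · exact (list_getD _).comp (primrec_evalNext hk hc (primrec_evalNext hk hc hs hl) hj) hi

theorem primrecPred_stepIdentity {k N j : α → ℕ} {c : α → SystemCode} {G h : α → List PolyCode}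
    {g : α → PolyCode} (hk : Primrec k) (hc : Primrec c) (hN : Primrec N) (hG : Primrec G)
    (hj : Primrec j) (hg : Primrec g) (hh : Primrec h) :
    PrimrecPred fun a => StepIdentity (k a) (c a) (N a) (G a) (j a) (g a) (h a) := by
  refine PrimrecPred.forall_lt_comp ?_ (nat_pow_comp hN hk)
  have hk' : Primrec fun p : α × ℕ => k p.1 := hk.comp fst
  have hx : Primrec fun p : α × ℕ => gridPoint (k p.1) (N p.1) p.2 :=
    primrec_gridPoint hk' (hN.comp fst) snd
  exact NatFrac.primrecPred_equiv
    (PolyCode.primrec_eval hk' (primrec_evalNext hk' (hc.comp fst) hx (hj.comp fst)) (hg.comp fst))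
    (PolyCode.primrec_evalCombination hk' hx (hh.comp fst) (hG.comp fst))

theorem primrecPred_commIdentity {k N j l i : α → ℕ} {c : α → SystemCode}
    {G h : α → List PolyCode} (hk : Primrec k) (hc : Primrec c) (hN : Primrec N) (hG : Primrec G)
    (hj : Primrec j) (hl : Primrec l) (hi : Primrec i) (hh : Primrec h) :
    PrimrecPred fun a => CommIdentity (k a) (c a) (N a) (G a) (j a) (l a) (i a) (h a) := by
  refine PrimrecPred.forall_lt_comp ?_ (nat_pow_comp hN hk)
  have hk' : Primrec fun p : α × ℕ => k p.1 := hk.comp fst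
  have hc' : Primrec fun p : α × ℕ => c p.1 := hc.comp fst
  have hx : Primrec fun p : α × ℕ => gridPoint (k p.1) (N p.1) p.2 :=
    primrec_gridPoint hk' (hN.comp fst) snd
  exact NatFrac.primrecPred_equiv
    (PolyCode.primrec_eval hk' (primrec_evalNext hk' hc' hx (hj.comp fst))
      (primrec_rhsCode hc' (hl.comp fst) (hi.comp fst)))
    (NatFrac.primrec_add
      (PolyCode.primrec_eval hk' (primrec_evalNext hk' hc' hx (hl.comp fst))
        (primrec_rhsCode hc' (hj.comp fst) (hi.comp fst)))
      (PolyCode.primrec_evalCombination hk' hx (hh.comp fst) (hG.comp fst)))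

theorem primrecPred_isCertificate {d k D : α → ℕ} {c : α → SystemCode} {G : α → List PolyCode}
    {H : α → List (List PolyCode)} (hd : Primrec d) (hk : Primrec k) (hc : Primrec c)
    (hD : Primrec D) (hG : Primrec G) (hH : Primrec H) :
    PrimrecPred fun a => IsCertificate (d a) (k a) (c a) (D a) (G a) (H a) := by
  have hN := primrec_gridSize hk hD
  refine PrimrecPred.and (PrimrecPred.forall_lt_comp ?_ hd) <|
    PrimrecPred.and (PrimrecPred.forall_mem_comp ?_ hG) <|
    PrimrecPred.and (PrimrecPred.forall_mem_comp ?_ hH) <|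
    PrimrecPred.and (PrimrecPred.forall_mem_comp ?_ hG) <|
    PrimrecPred.and (PrimrecPred.forall_lt_comp ?_ hd) <|
    PrimrecPred.forall_lt_comp ?_ hd
  · refine PrimrecPred.forall_lt_comp ?_ (hk.comp fst)
    have h₁ : Primrec fun p : (α × ℕ) × ℕ => p.1.1 := fst.comp fst
    exact PolyCode.primrecPred_exponentsLE (hk.comp h₁) (hD.comp h₁)
      (primrec_rhsCode (hc.comp h₁) (snd.comp fst) snd)
  · exact PolyCode.primrecPred_exponentsLE (hk.comp fst) (hD.comp fst) snd
  · refine PrimrecPred.forall_mem_comp ?_ snd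
    have h₁ : Primrec fun p : (α × List PolyCode) × PolyCode => p.1.1 := fst.comp fst
    exact PolyCode.primrecPred_exponentsLE (hk.comp h₁) (hD.comp h₁) snd
  · exact NatFrac.primrecPred_equiv (PolyCode.primrec_eval (hk.comp fst)
      ((primrec_evalInit hk hc).comp fst) snd) (.const _)
  · refine PrimrecPred.forall_mem_comp ?_ (hG.comp fst)
    refine PrimrecPred.exists_mem_comp ?_ (hH.comp (fst.comp fst))
    have h₁ : Primrec fun p : ((α × ℕ) × PolyCode) × List PolyCode => p.1.1.1 :=
      fst.comp (fst.comp fst)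
    exact primrecPred_stepIdentity (hk.comp h₁) (hc.comp h₁) (hN.comp h₁) (hG.comp h₁)
      (snd.comp (fst.comp fst)) (snd.comp fst) snd
  · refine PrimrecPred.forall_lt_comp ?_ (hd.comp fst)
    refine PrimrecPred.forall_lt_comp ?_ (hk.comp (fst.comp fst))
    refine PrimrecPred.exists_mem_comp ?_
      (hH.comp (fst.comp (fst.comp fst)))
    have h₁ : Primrec fun p : (((α × ℕ) × ℕ) × ℕ) × List PolyCode => p.1.1.1.1 :=
      fst.comp (fst.comp (fst.comp fst))
    exact primrecPred_commIdentity (hk.comp h₁) (hc.comp h₁) (hN.comp h₁) (hG.comp h₁)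
      (snd.comp (fst.comp (fst.comp fst))) (snd.comp (fst.comp fst)) (snd.comp fst) snd

end SystemCode

end Evaluation

/-! ### Decidability -/

open Primrec in
/-- Both solvability and unsolvability have finite witnesses that can be tested, so solvability is
decidable by Post's theorem. -/
theorem SystemCode.computablePred_solvable :
    ComputablePred fun x : ℕ × ℕ × SystemCode => (SystemCode.decode x.1 x.2.1 x.2.2).Solvable := by
  rw [ComputablePred.computable_iff_re_compl_re']
  constructor
  · have h : PrimrecRel fun (x : ℕ × ℕ × SystemCode)
        (y : ℕ × List PolyCode × List (List PolyCode)) =>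
          IsCertificate x.1 x.2.1 x.2.2 y.1 y.2.1 y.2.2 :=
      PrimrecPred.primrecRel <| primrecPred_isCertificate (fst.comp fst)
        (fst.comp (snd.comp fst)) (snd.comp (snd.comp fst)) (fst.comp snd)
        (fst.comp (snd.comp snd)) (snd.comp (snd.comp snd))
    refine h.rePred_exists.of_eq fun x => ?_
    simp only [solvable_iff_exists_isCertificate, Prod.exists]
  · have h : PrimrecRel fun (x : ℕ × ℕ × SystemCode) (y : List ℕ × ℕ × ℕ × ℕ) =>
        IsObstruction x.1 x.2.1 x.2.2 y.1 y.2.1 y.2.2.1 y.2.2.2 :=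
      PrimrecPred.primrecRel <| primrecPred_isObstruction (fst.comp fst)
        (fst.comp (snd.comp fst)) (snd.comp (snd.comp fst)) (fst.comp snd)
        (fst.comp (snd.comp snd)) (fst.comp (snd.comp (snd.comp snd)))
        (snd.comp (snd.comp (snd.comp snd)))
    refine h.rePred_exists.of_eq fun x => ?_
    simp only [not_solvable_iff_exists_isObstruction, Prod.exists]

/-- (1) There is one algorithm that, given `d`, `k` and a presentation of a `d`-variate polyrec
system in `k` unknowns, decides whether the system has a solution. (2) A polyrec system has a
solution iff its associated polynomial automata are commutative. (3), (4) The codes of solvable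
systems are an effective syntax for the polyrec sequences: each of them defines exactly one
sequence, and the sequences so defined are precisely the polyrec ones. -/
theorem mainTheorem3 :
    ComputablePred (fun x : ℕ × ℕ × SystemCode =>
      (SystemCode.decode x.1 x.2.1 x.2.2).Solvable) ∧
    (∀ (d k : ℕ) (S : PolyrecSystem d k),
      S.Solvable ↔ ∀ i : Fin k, IsCommutativeSeries (S.automaton i).semantics) ∧
    (∀ (d k : ℕ) (c : SystemCode), (SystemCode.decode d (k + 1) c).Solvable →
      ∃! f : (Fin d → ℕ) → ℚ, (SystemCode.decode d (k + 1) c).Defines f) ∧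
    (∀ (d : ℕ) (f : (Fin d → ℕ) → ℚ),
      IsPolyrec f ↔ ∃ (k : ℕ) (c : SystemCode), (SystemCode.decode d (k + 1) c).Defines f) := by
  refine ⟨SystemCode.computablePred_solvable, fun d k S =>
    PolyrecSystem.solvable_iff_isCommutativeSeries, fun d k c => ?_, fun d f => ?_⟩
  · rintro ⟨g, hg⟩
    exact ⟨g 0, ⟨g, hg, rfl⟩, fun f ⟨g', hg', hf⟩ => by rw [← hf, hg'.unique hg]⟩
  · constructor
    · rintro ⟨k, S, hS⟩
      obtain ⟨c, rfl⟩ := SystemCode.decode_surjective d (k + 1) S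
      exact ⟨k, c, hS⟩
    · rintro ⟨k, c, hc⟩
      exact ⟨k, _, hc⟩
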